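/- Let $q>2$, $p\ge \frac{q}{q-1}$, $k\in(0,1)$ and $x_0\in\mathbb R$, and write $d(x)=|x-x_0|$. Let $V:\mathbb R\to\mathbb R$ be a potential, differentiable at Lebesgue-almost every point, of the form $$V(x)=d(x)^p+\alpha(x)\cos(x),$$ where $\alpha:\mathbb R\to\mathbb R$ satisfies $\alpha(x)=k\,d(x)^{p-1}$ for $|x|>1$ and is bounded on $[-1,1]$. Then $e^{-V}$ is Lebesgue integrable, $V$ is not convex (so the probability measure $d\mu=\frac{e^{-V}}{\int e^{-V}d\lambda}\,d\lambda$, with $\lambda$ the Lebesgue measure on $\mathbb R$, is given by a density that is not log-concave), and $\mu$ satisfies the modified log-Sobolev inequality MLS$(H_q)$: there is a constant $C\in(0,\infty)$ such that for every $f\in C^\infty(\mathbb R)$ $$\int f^2\log\frac{f^2}{\int f^2d\mu}\,d\mu\ \le\ C\int H_q\!\left(\frac{|f'|}{f}\right)f^2\,d\mu ,\qquad H_q(x)=\begin{cases}x^2,&|x|\le 1,\\ |x|^q,&|x|\ge 1.\end{cases}$$ Here the inequality is understood to be void if the right-hand side is infinite; if the right-hand side is finite, then $\int f^2d\mu<\infty$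 and $f^2\log\frac{f^2}{\int f^2d\mu}$ is $\mu$-integrable. The integrand on the right is read as $0$ where $f=0$, and that on the left is read as $0$ where $f=0$. -/

import Mathlib

open MeasureTheory
open scoped ContDiff

namespace ModifiedLogSobolev

noncomputable section

/-- The modification `H_q` of `|x| ^ q`: quadratic on `[-1, 1]`, equal to `|x| ^ q` outside. -/
def modH (q x : ℝ) : ℝ :=
  if |x| ≤ 1 then x ^ 2 else |x| ^ q

/-- The energy density `H_q (|f'| / f) * f ^ 2`. It is `0` where `f` vanishes; for differentiable
`f` this convention is immaterial, since `{x | f x = 0 ∧ f' x ≠ 0}` is countable. -/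
def energyDensity (q : ℝ) (f : ℝ → ℝ) (x : ℝ) : ℝ :=
  modH q (|deriv f x| / f x) * f x ^ 2

/-- The integrand `f ^ 2 * log (f ^ 2 / μ (f ^ 2))` of the entropy of `f ^ 2`. -/
def entropyDensity (μ : Measure ℝ) (f : ℝ → ℝ) (x : ℝ) : ℝ :=
  f x ^ 2 * Real.log (f x ^ 2 / ∫ y, f y ^ 2 ∂μ)

/-- The inequality MLS(H_q) for a measure on the real line: one constant `C` works for all smooth
`f`. If the right-hand side is infinite there is nothing to say about `f`; if it is finite, the
left-hand side has to be meaningful (both integrals in it converge) and the inequality holds. -/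
def SatisfiesMLS (q : ℝ) (μ : Measure ℝ) : Prop :=
  ∃ C : ℝ, 0 < C ∧ ∀ f : ℝ → ℝ, ContDiff ℝ ∞ f → Integrable (energyDensity q f) μ →
    Integrable (fun x => f x ^ 2) μ ∧
    Integrable (entropyDensity μ f) μ ∧
    ∫ x, entropyDensity μ f x ∂μ ≤ C * ∫ x, energyDensity q f x ∂μ

/-- The measure `e^{-V} dλ / ∫ e^{-V} dλ` on the real line, `λ` being Lebesgue measure. -/
def gibbs (V : ℝ → ℝ) : Measure ℝ :=
  volume.withDensity fun x => ENNReal.ofReal (Real.exp (-V x) / ∫ y, Real.exp (-V y))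

end

end ModifiedLogSobolev

/-!
Outside a ball around `x₀` the potential is smooth and its outward derivative dominates
`|x - x₀| ^ (p - 1)`. Integrating `f ^ 2 * e ^ (-V)` by parts in this region and Cauchy–Schwarz on
its complement give a Poincaré inequality, and Cauchy–Schwarz along `[x₀, x]` shows that a function
of finite energy grows at most like `exp (A * |x - x₀| ^ p)`. If `∫ f ^ 2 ∂μ = 1`, the part of the
entropy where `|f| ≤ 4` is quadratic in `|f| - 1` and is handled by the Poincaré inequality. On the
rest `log f ^ 2` is at most a constant times `1 + |x - x₀| ^ p` plus the energy, so it remains to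
bound the `p`-th moment of `f ^ 2` there. Integrating by parts once more against `V'` and applying
Young's inequality with the exponents `q` and `q / (q - 1) ≤ p` bounds this moment by the energy.

Convexity fails because the derivative of `cos` eventually outweighs the growth of
`|x - x₀| ^ (p - 1)` over a half period.
-/

namespace ModifiedLogSobolev

open Set Filter Topology

lemma sq_integral_le {α : Type*} [MeasurableSpace α] {μ : Measure α} [IsFiniteMeasure μ]
    {g : α → ℝ} (hg : Integrable g μ) (hg2 : Integrable (fun x => g x ^ 2) μ) :
    (∫ x, g x ∂μ) ^ 2 ≤ μ.real univ * ∫ x, g x ^ 2 ∂μ := by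
  rcases eq_zero_or_neZero μ with rfl | hμ
  · simp
  have hpos : 0 < μ.real univ := measureReal_univ_pos
  have jensen : (⨍ x, g x ∂μ) ^ 2 ≤ ⨍ x, g x ^ 2 ∂μ :=
    (even_two.convexOn_pow).map_average_le (continuous_pow 2).continuousOn isClosed_univ
      (by simp) hg hg2
  rw [average_eq, average_eq, smul_eq_mul, smul_eq_mul] at jensen
  calc (∫ x, g x ∂μ) ^ 2 = μ.real univ ^ 2 * ((μ.real univ)⁻¹ * ∫ x, g x ∂μ) ^ 2 := by field_simp
    _ ≤ μ.real univ ^ 2 * ((μ.real univ)⁻¹ * ∫ x, g x ^ 2 ∂μ) := by gcongr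
    _ = μ.real univ * ∫ x, g x ^ 2 ∂μ := by field_simp

lemma sq_sub_le_mul_setIntegral_sq {f : ℝ → ℝ} (hf : ContDiff ℝ 1 f) (a b : ℝ) :
    (f b - f a) ^ 2 ≤ |b - a| * ∫ x in uIoc a b, deriv f x ^ 2 := by
  have hf' : Continuous (deriv f) := hf.continuous_deriv le_rfl
  have hint : ∀ g : ℝ → ℝ, Continuous g → IntegrableOn g (uIoc a b) := fun g hg =>
    intervalIntegrable_iff.1 (hg.intervalIntegrable a b)
  have : IsFiniteMeasure (volume.restrict (uIoc a b)) := ⟨by simp [uIoc]⟩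
  rw [← intervalIntegral.integral_deriv_eq_sub (fun x _ => (hf.differentiable one_ne_zero) x)
    (hf'.intervalIntegrable a b), ← sq_abs, intervalIntegral.abs_intervalIntegral_eq, sq_abs]
  convert sq_integral_le (hint _ hf') (hint _ (hf'.pow 2)) using 2
  simp [Measure.real, uIoc, max_sub_min_eq_abs]

section HalfLine

variable {F F' q w : ℝ → ℝ} {a : ℝ}

lemma setIntegral_Ioi_le_of_hasDerivAt (hF : ∀ x ∈ Ici a, HasDerivAt F (F' x) x)
    (hF0 : ∀ x ∈ Ici a, 0 ≤ F x) (hq : IntegrableOn q (Ioi a)) (hw : ContinuousOn w (Ici a))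
    (hw0 : ∀ x ∈ Ici a, 0 ≤ w x) (hle : ∀ x ∈ Ici a, F' x ≤ q x - w x) :
    IntegrableOn w (Ioi a) ∧ ∫ x in Ioi a, w x ≤ F a + ∫ x in Ioi a, q x := by
  have hw_int (b : ℝ) : IntegrableOn w (Icc a b) :=
    (hw.mono Icc_subset_Ici_self).integrableOn_compact isCompact_Icc
  have hq_int (b : ℝ) (hb : a ≤ b) : IntervalIntegrable q volume a b :=
    (intervalIntegrable_iff_integrableOn_Ioc_of_le hb).2 (hq.mono_set Ioc_subset_Ioi_self)
  have key : ∀ b ∈ Ici a, ∫ x in a..b, w x ≤ F a + ∫ x in a..b, q x := fun b hb => by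
    have hsub : Icc a b ⊆ Ici a := Icc_subset_Ici_self
    have hFTC : F b - F a ≤ ∫ x in a..b, q x - w x :=
      intervalIntegral.sub_le_integral_of_hasDeriv_right_of_le hb
        (fun x hx => (hF x (hsub hx)).continuousAt.continuousWithinAt)
        (fun x hx => (hF x hx.1.le).hasDerivWithinAt)
        (((intervalIntegrable_iff_integrableOn_Icc_of_le hb).1 (hq_int b hb)).sub (hw_int b))
        (fun x hx => hle x hx.1.le)
    rw [intervalIntegral.integral_sub (hq_int b hb)
      ((intervalIntegrable_iff_integrableOn_Icc_of_le hb).2 (hw_int b))] at hFTC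
    linarith [hF0 b hb]
  have hq_lim := (intervalIntegral_tendsto_integral_Ioi a hq tendsto_id).const_add (F a)
  have hw_on : IntegrableOn w (Ioi a) := by
    refine integrableOn_Ioi_of_intervalIntegral_norm_bounded (F a + (∫ x in Ioi a, q x) + 1) a
      (fun b => (hw_int b).mono_set Ioc_subset_Icc_self) tendsto_id ?_
    filter_upwards [eventually_ge_atTop a, hq_lim.eventually (gt_mem_nhds (lt_add_one _))]
      with b hb hlt
    have hnorm : ∫ x in a..b, ‖w x‖ = ∫ x in a..b, w x :=
      intervalIntegral.integral_congr fun x hx =>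
        Real.norm_of_nonneg (hw0 x (uIcc_of_le hb ▸ hx).1)
    exact hnorm.trans_le ((key b hb).trans hlt.le)
  exact ⟨hw_on, le_of_tendsto_of_tendsto (intervalIntegral_tendsto_integral_Ioi a hw_on tendsto_id)
    hq_lim ((eventually_ge_atTop a).mono key)⟩

lemma integrableOn_Ioi_comp_neg_iff : IntegrableOn (fun x => w (-x)) (Ioi (-a)) ↔
    IntegrableOn w (Iio a) := by
  simpa [Function.comp_def] using
    (Measure.measurePreserving_neg (volume : Measure ℝ)).integrableOn_comp_preimage
      (Homeomorph.neg ℝ).measurableEmbedding (f := w) (s := Iio a)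

lemma setIntegral_Iio_le_of_hasDerivAt (hF : ∀ x ∈ Iic a, HasDerivAt F (F' x) x)
    (hF0 : ∀ x ∈ Iic a, 0 ≤ F x) (hq : IntegrableOn q (Iio a)) (hw : ContinuousOn w (Iic a))
    (hw0 : ∀ x ∈ Iic a, 0 ≤ w x) (hle : ∀ x ∈ Iic a, -F' x ≤ q x - w x) :
    IntegrableOn w (Iio a) ∧ ∫ x in Iio a, w x ≤ F a + ∫ x in Iio a, q x := by
  have hmem : ∀ x ∈ Ici (-a), -x ∈ Iic a := fun x hx => mem_Iic.2 (neg_le.1 hx)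
  have hF_neg : ∀ x ∈ Ici (-a), HasDerivAt (fun x => F (-x)) (-F' (-x)) x := fun x hx => by
    simpa [Function.comp_def] using (hF _ (hmem x hx)).comp x (hasDerivAt_neg x)
  have h := setIntegral_Ioi_le_of_hasDerivAt (w := fun x => w (-x)) hF_neg
    (fun x hx => hF0 _ (hmem x hx)) (integrableOn_Ioi_comp_neg_iff.2 hq)
    (hw.comp continuous_neg.continuousOn hmem) (fun x hx => hw0 _ (hmem x hx))
    (fun x hx => hle _ (hmem x hx))
  rw [integrableOn_Ioi_comp_neg_iff, integral_comp_neg_Ioi, integral_comp_neg_Ioi, neg_neg,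
    integral_Iic_eq_integral_Iio, integral_Iic_eq_integral_Iio] at h
  exact h

end HalfLine

lemma setOf_lt_abs_sub (x₀ R : ℝ) : {x | R < |x - x₀|} = Iio (x₀ - R) ∪ Ioi (x₀ + R) := by
  ext x
  simp only [mem_ofPred_eq, lt_abs, mem_union, mem_Iio, mem_Ioi]
  constructor <;> rintro (h | h) <;> [right; left; right; left] <;> linarith

lemma setIntegral_lt_abs_sub_le_of_hasDerivAt {F F' q w : ℝ → ℝ} {x₀ R : ℝ} (hR : 0 < R)
    (hF : ∀ x, R ≤ |x - x₀| → HasDerivAt F (F' x) x) (hF0 : ∀ x, R ≤ |x - x₀| → 0 ≤ F x)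
    (hq : IntegrableOn q {x | R < |x - x₀|}) (hw : ContinuousOn w {x | R ≤ |x - x₀|})
    (hw0 : ∀ x, R ≤ |x - x₀| → 0 ≤ w x)
    (hle : ∀ x, R ≤ |x - x₀| → SignType.sign (x - x₀) * F' x ≤ q x - w x) :
    IntegrableOn w {x | R < |x - x₀|} ∧
      ∫ x in {x | R < |x - x₀|}, w x ≤
        F (x₀ - R) + F (x₀ + R) + ∫ x in {x | R < |x - x₀|}, q x := by
  have hright : ∀ x ∈ Ici (x₀ + R), R ≤ |x - x₀| ∧ SignType.sign (x - x₀) = 1 := fun x hx => by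
    have hx' : R ≤ x - x₀ := by linarith [mem_Ici.1 hx]
    exact ⟨hx'.trans (le_abs_self _), sign_pos (hR.trans_le hx')⟩
  have hleft : ∀ x ∈ Iic (x₀ - R), R ≤ |x - x₀| ∧ SignType.sign (x - x₀) = -1 := fun x hx => by
    have hx' : R ≤ -(x - x₀) := by linarith [mem_Iic.1 hx]
    exact ⟨hx'.trans (neg_le_abs _), sign_neg (by linarith)⟩
  have hdisj : Disjoint (Iio (x₀ - R)) (Ioi (x₀ + R)) := (Ioi_disjoint_Iio_of_le (by linarith)).symm
  rw [setOf_lt_abs_sub, integrableOn_union] at hq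
  obtain ⟨hwr, hr⟩ := setIntegral_Ioi_le_of_hasDerivAt (fun x hx => hF x (hright x hx).1)
    (fun x hx => hF0 x (hright x hx).1) hq.2 (hw.mono fun x hx => (hright x hx).1)
    (fun x hx => hw0 x (hright x hx).1) fun x hx => by
      simpa [(hright x hx).2] using hle x (hright x hx).1
  obtain ⟨hwl, hl⟩ := setIntegral_Iio_le_of_hasDerivAt (fun x hx => hF x (hleft x hx).1)
    (fun x hx => hF0 x (hleft x hx).1) hq.1 (hw.mono fun x hx => (hleft x hx).1)
    (fun x hx => hw0 x (hleft x hx).1) fun x hx => by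
      simpa [(hleft x hx).2] using hle x (hleft x hx).1
  rw [setOf_lt_abs_sub, setIntegral_union hdisj measurableSet_Ioi hwl hwr,
    setIntegral_union hdisj measurableSet_Ioi hq.1 hq.2]
  exact ⟨hwl.union hwr, by linarith⟩

/-- The density of `gibbs V` with respect to Lebesgue measure. -/
noncomputable def gibbsDensity (V : ℝ → ℝ) (x : ℝ) : ℝ :=
  Real.exp (-V x) / ∫ y, Real.exp (-V y)

section Gibbs

variable {V : ℝ → ℝ}

lemma gibbsDensity_pos (hV : Integrable fun x => Real.exp (-V x)) (x : ℝ) :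
    0 < gibbsDensity V x :=
  div_pos (Real.exp_pos _) (integral_exp_pos hV)

lemma hasDerivAt_gibbsDensity {x : ℝ} (hV : DifferentiableAt ℝ V x) :
    HasDerivAt (gibbsDensity V) (-deriv V x * gibbsDensity V x) x := by
  refine HasDerivAt.congr_deriv (f := gibbsDensity V)
    (hV.hasDerivAt.fun_neg.exp.div_const (∫ y, Real.exp (-V y))) ?_
  rw [gibbsDensity]
  ring

lemma gibbs_eq_withDensity (V : ℝ → ℝ) :
    gibbs V = volume.withDensity fun x => ENNReal.ofReal (gibbsDensity V x) := rfl

lemma setIntegral_gibbs (V g : ℝ → ℝ) (s : Set ℝ) :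
    ∫ x in s, g x ∂gibbs V = ∫ x in s, g x * gibbsDensity V x := by
  refine (setIntegral_tilted (fun x => -V x) g s).trans ?_
  simp only [gibbsDensity, smul_eq_mul, mul_comm]

lemma integrableOn_gibbs_iff (hV : Integrable fun x => Real.exp (-V x)) {g : ℝ → ℝ} {s : Set ℝ} :
    IntegrableOn g s (gibbs V) ↔ IntegrableOn (fun x => g x * gibbsDensity V x) s := by
  have hmeas : AEMeasurable (gibbsDensity V) := hV.aemeasurable.div_const _
  rw [IntegrableOn, gibbs_eq_withDensity, restrict_withDensity',
    integrable_withDensity_iff_integrable_smul₀' hmeas.ennreal_ofReal.restrict (by simp)]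
  simp only [ENNReal.toReal_ofReal (gibbsDensity_pos hV _).le, smul_eq_mul,
    mul_comm (gibbsDensity V _), IntegrableOn]

lemma isProbabilityMeasure_gibbs (hV : Integrable fun x => Real.exp (-V x)) :
    IsProbabilityMeasure (gibbs V) :=
  isProbabilityMeasure_tilted hV

lemma gibbs_absolutelyContinuous (V : ℝ → ℝ) : gibbs V ≪ volume :=
  withDensity_absolutelyContinuous _ _

end Gibbs

/-- Confining potentials of power type: `V` grows at most like `|x - x₀| ^ p`, and at distance at
least `R` from `x₀` its outward derivative is at least `c * |x - x₀| ^ (p - 1)`. -/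
structure HasPowerGrowth (V : ℝ → ℝ) (x₀ R c M p : ℝ) : Prop where
  one_le_p : 1 ≤ p
  one_le_R : 1 ≤ R
  c_pos : 0 < c
  M_nonneg : 0 ≤ M
  integrable_exp_neg : Integrable fun x => Real.exp (-V x)
  le_rpow : ∀ x, V x ≤ M * (1 + |x - x₀| ^ p)
  differentiableAt : ∀ x, R ≤ |x - x₀| → DifferentiableAt ℝ V x
  le_sign_mul_deriv : ∀ x, R ≤ |x - x₀| →
    c * |x - x₀| ^ (p - 1) ≤ SignType.sign (x - x₀) * deriv V x

lemma self_le_one_add_rpow {d p : ℝ} (hd : 0 ≤ d) (hp : 1 ≤ p) : d ≤ 1 + d ^ p := by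
  rcases le_total d 1 with h | h
  · linarith [Real.rpow_nonneg hd p]
  · linarith [Real.self_le_rpow_of_one_le h hp]

lemma mul_rpow_sub_one_self {d p : ℝ} (hd : 0 ≤ d) (hp : p ≠ 0) : d * d ^ (p - 1) = d ^ p := by
  rw [mul_comm, ← Real.rpow_add_one' hd (by simpa using hp), sub_add_cancel]

lemma mul_rpow_sub_one_le {R d p : ℝ} (hR : 0 ≤ R) (hd : 0 ≤ d) (hp : 1 ≤ p) :
    R * d ^ (p - 1) ≤ d ^ p / 2 + (2 * R) ^ p := by
  have hp0 : p ≠ 0 := by linarith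
  rcases le_total (2 * R) d with h | h
  · have : 2 * R * d ^ (p - 1) ≤ d ^ p := mul_rpow_sub_one_self hd hp0 ▸ by gcongr
    have : 0 ≤ (2 * R) ^ p := by positivity
    linarith
  · have : (2 * R) * d ^ (p - 1) ≤ (2 * R) ^ p := by
      rw [← mul_rpow_sub_one_self (by positivity : 0 ≤ 2 * R) hp0]
      gcongr
    have : 0 ≤ d ^ p := by positivity
    linarith [Real.rpow_nonneg (mul_nonneg zero_le_two hR) p]

namespace HasPowerGrowth

variable {V : ℝ → ℝ} {x₀ R c M p : ℝ}

lemma setIntegral_uIoc_le (h : HasPowerGrowth V x₀ R c M p) {g : ℝ → ℝ} (hg : Continuous g)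
    (hg0 : ∀ x, 0 ≤ g x) (hg_int : Integrable g (gibbs V)) (x : ℝ) :
    ∫ y in uIoc x₀ x, g y ≤
      (∫ y, Real.exp (-V y)) * Real.exp (M * (1 + |x - x₀| ^ p)) * ∫ y, g y ∂gibbs V := by
  have hV := h.integrable_exp_neg
  have hV_le : ∀ y ∈ uIoc x₀ x, V y ≤ M * (1 + |x - x₀| ^ p) := fun y hy => by
    have hyx : |y - x₀| ≤ |x - x₀| := abs_sub_left_of_mem_uIcc (uIoc_subset_uIcc hy)
    have := h.M_nonneg
    have := h.one_le_p
    exact (h.le_rpow y).trans (by gcongr)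
  set Z := ∫ y, Real.exp (-V y)
  set E := M * (1 + |x - x₀| ^ p)
  have hZ : 0 < Z := integral_exp_pos hV
  have hρ : ∀ y ∈ uIoc x₀ x, 1 ≤ Z * Real.exp E * gibbsDensity V y := fun y hy => by
    rw [gibbsDensity, mul_right_comm, mul_div_cancel₀ _ hZ.ne', ← Real.exp_add]
    exact Real.one_le_exp (by linarith [hV_le y hy])
  calc ∫ y in uIoc x₀ x, g y
      ≤ ∫ y in uIoc x₀ x, Z * Real.exp E * (g y * gibbsDensity V y) := by
        refine setIntegral_mono_on (intervalIntegrable_iff.1 (hg.intervalIntegrable _ _))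
          (((integrableOn_gibbs_iff hV).1 hg_int.integrableOn).const_mul _) measurableSet_uIoc
          fun y hy => ?_
        linarith [mul_le_mul_of_nonneg_left (hρ y hy) (hg0 y)]
    _ = Z * Real.exp E * ∫ y in uIoc x₀ x, g y ∂gibbs V := by
        rw [integral_const_mul, setIntegral_gibbs]
    _ ≤ Z * Real.exp E * ∫ y, g y ∂gibbs V := mul_le_mul_of_nonneg_left
        (setIntegral_le_integral hg_int (ae_of_all _ hg0)) (by positivity)

lemma exists_sq_sub_le (h : HasPowerGrowth V x₀ R c M p) :
    ∃ A, 0 ≤ A ∧ ∀ f : ℝ → ℝ, ContDiff ℝ 1 f → Integrable (fun x => deriv f x ^ 2) (gibbs V) →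
      ∀ x, (f x - f x₀) ^ 2 ≤
        Real.exp (A * (1 + |x - x₀| ^ p)) * ∫ y, deriv f y ^ 2 ∂gibbs V := by
  set Z := ∫ y, Real.exp (-V y)
  have hZ : 0 < Z := integral_exp_pos h.integrable_exp_neg
  refine ⟨1 + (Z + M), by linarith [h.M_nonneg], fun f hf hD x => ?_⟩
  set d := |x - x₀|
  have hd : 0 ≤ d := abs_nonneg _
  have hdp : 0 ≤ d ^ p := by positivity
  have hd_exp : d ≤ Real.exp (1 + d ^ p) :=
    (self_le_one_add_rpow hd h.one_le_p).trans (by linarith [Real.add_one_le_exp (1 + d ^ p)])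
  have hZ_exp : Z ≤ Real.exp (Z * (1 + d ^ p)) := by
    nlinarith [Real.add_one_le_exp (Z * (1 + d ^ p))]
  have : 0 ≤ ∫ y, deriv f y ^ 2 ∂gibbs V := integral_nonneg fun y => sq_nonneg _
  calc (f x - f x₀) ^ 2 ≤ d * ∫ y in uIoc x₀ x, deriv f y ^ 2 :=
        sq_sub_le_mul_setIntegral_sq hf x₀ x
    _ ≤ d * (Z * Real.exp (M * (1 + d ^ p)) * ∫ y, deriv f y ^ 2 ∂gibbs V) :=
        mul_le_mul_of_nonneg_left (h.setIntegral_uIoc_le ((hf.continuous_deriv le_rfl).pow 2)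
          (fun y => sq_nonneg _) hD x) hd
    _ ≤ Real.exp (1 + d ^ p) * (Real.exp (Z * (1 + d ^ p)) * Real.exp (M * (1 + d ^ p)) *
          ∫ y, deriv f y ^ 2 ∂gibbs V) := by gcongr
    _ = _ := by rw [← Real.exp_add, ← mul_assoc, ← Real.exp_add]; ring_nf

end HasPowerGrowth

lemma sign_mul_le_abs (x y : ℝ) : SignType.sign x * y ≤ |y| := by
  rcases (SignType.sign x).trichotomy with h | h | h <;> simp [h, neg_le_abs, le_abs_self]

lemma integrable_and_integral_le_of_integrableOn {α : Type*} [MeasurableSpace α] {μ : Measure α}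
    {F G : α → ℝ} {T : Set α} (hT : MeasurableSet T) (hF : AEStronglyMeasurable F μ)
    (hF0 : ∀ x, 0 ≤ F x) (hFT : IntegrableOn F T μ) (hG : Integrable G μ) (hG0 : ∀ x, 0 ≤ G x)
    (hle : ∀ x ∈ Tᶜ, F x ≤ G x) :
    Integrable F μ ∧ ∫ x, F x ∂μ ≤ ∫ x in T, F x ∂μ + ∫ x, G x ∂μ := by
  have hFc : IntegrableOn F Tᶜ μ := hG.integrableOn.mono' hF.restrict <|
    (ae_restrict_mem hT.compl).mono fun x hx => by
      rw [Real.norm_of_nonneg (hF0 x)]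
      exact hle x hx
  have hFint : Integrable F μ := by simpa using hFT.union hFc
  refine ⟨hFint, ?_⟩
  rw [← integral_add_compl hT hFint]
  gcongr
  exact (setIntegral_mono_on hFc hG.integrableOn hT.compl hle).trans
    (setIntegral_le_integral hG (ae_of_all _ hG0))

lemma setIntegral_add_const_mul_le {α : Type*} [MeasurableSpace α] {μ : Measure α} {F G : α → ℝ}
    {k : ℝ} (hF : Integrable F μ) (hF0 : ∀ x, 0 ≤ F x) (hG : Integrable G μ) (hG0 : ∀ x, 0 ≤ G x)
    (hk : 0 ≤ k) (s : Set α) :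
    ∫ x in s, F x + k * G x ∂μ ≤ ∫ x, F x ∂μ + k * ∫ x, G x ∂μ := by
  rw [← integral_const_mul, ← integral_add hF (hG.const_mul k)]
  exact setIntegral_le_integral (hF.add (hG.const_mul k))
    (ae_of_all _ fun x => add_nonneg (hF0 x) (mul_nonneg hk (hG0 x)))

namespace HasPowerGrowth

variable {V : ℝ → ℝ} {x₀ R c M p : ℝ}

lemma R_pos (h : HasPowerGrowth V x₀ R c M p) : 0 < R := zero_lt_one.trans_le h.one_le_R

/-- Integration by parts on both tails: differentiate `H * gibbsDensity V` outwards and use that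
`-V'` is at most `-c * |x - x₀| ^ (p - 1)` there. -/
lemma setIntegral_tail_le (h : HasPowerGrowth V x₀ R c M p) {H H' Q W : ℝ → ℝ}
    (hH : ∀ x, R ≤ |x - x₀| → HasDerivAt H (H' x) x) (hH0 : ∀ x, R ≤ |x - x₀| → 0 ≤ H x)
    (hQ : Integrable Q (gibbs V)) (hW : Continuous W) (hW0 : ∀ x, 0 ≤ W x)
    (hle : ∀ x, R ≤ |x - x₀| →
      SignType.sign (x - x₀) * H' x - H x * (c * |x - x₀| ^ (p - 1)) ≤ Q x - W x) :
    IntegrableOn W {x | R < |x - x₀|} (gibbs V) ∧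
      ∫ x in {x | R < |x - x₀|}, W x ∂gibbs V ≤
        H (x₀ - R) * gibbsDensity V (x₀ - R) + H (x₀ + R) * gibbsDensity V (x₀ + R) +
          ∫ x in {x | R < |x - x₀|}, Q x ∂gibbs V := by
  have hV := h.integrable_exp_neg
  set ρ := gibbsDensity V
  have hρ0 : ∀ x, 0 ≤ ρ x := fun x => (gibbsDensity_pos hV x).le
  have hρ : ∀ x, R ≤ |x - x₀| → HasDerivAt ρ (-deriv V x * ρ x) x := fun x hx =>
    hasDerivAt_gibbsDensity (h.differentiableAt x hx)
  rw [integrableOn_gibbs_iff hV, setIntegral_gibbs, setIntegral_gibbs]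
  refine setIntegral_lt_abs_sub_le_of_hasDerivAt h.R_pos
    (fun x hx => (hH x hx).fun_mul (hρ x hx)) (fun x hx => mul_nonneg (hH0 x hx) (hρ0 x))
    ((integrableOn_gibbs_iff hV).1 hQ.integrableOn)
    (fun x hx => (hW.continuousAt.mul (hρ x hx).continuousAt).continuousWithinAt)
    (fun x _ => mul_nonneg (hW0 x) (hρ0 x)) fun x hx => ?_
  have hdrift := mul_le_mul_of_nonneg_left (h.le_sign_mul_deriv x hx) (hH0 x hx)
  have hweighted := mul_le_mul_of_nonneg_right (hle x hx) (hρ0 x)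
  have := mul_le_mul_of_nonneg_right hdrift (hρ0 x)
  linarith

lemma poincare_tail (h : HasPowerGrowth V x₀ R c M p) {g : ℝ → ℝ} (hg : Differentiable ℝ g)
    (hD : Integrable (fun x => deriv g x ^ 2) (gibbs V)) :
    IntegrableOn (fun x => g x ^ 2) {x | R < |x - x₀|} (gibbs V) ∧
      ∫ x in {x | R < |x - x₀|}, g x ^ 2 ∂gibbs V ≤
        2 / c * (g (x₀ - R) ^ 2 * gibbsDensity V (x₀ - R) +
          g (x₀ + R) ^ 2 * gibbsDensity V (x₀ + R) + 2 / c * ∫ x, deriv g x ^ 2 ∂gibbs V) := by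
  have hc := h.c_pos
  obtain ⟨hint, hle⟩ := h.setIntegral_tail_le (H := fun x => g x ^ 2)
    (W := fun x => c / 2 * g x ^ 2) (fun x _ => (hg x).hasDerivAt.fun_pow 2)
    (fun x _ => sq_nonneg _) (hD.const_mul (2 / c)) ((hg.continuous.pow 2).const_mul _)
    (fun x => by positivity) fun x hx => by
      have hdrift : g x ^ 2 * c ≤ g x ^ 2 * (c * |x - x₀| ^ (p - 1)) := by
        gcongr
        exact le_mul_of_one_le_right hc.le
          (Real.one_le_rpow (h.one_le_R.trans hx) (sub_nonneg.2 h.one_le_p))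
      have hsign : SignType.sign (x - x₀) * (2 * g x * deriv g x) ≤ 2 * |g x| * |deriv g x| := by
        simpa only [abs_mul, abs_two] using sign_mul_le_abs (x - x₀) (2 * g x * deriv g x)
      have young : c / 2 * (|g x| - 2 / c * |deriv g x|) ^ 2 =
          c / 2 * g x ^ 2 - 2 * |g x| * |deriv g x| + 2 / c * deriv g x ^ 2 := by
        rw [← sq_abs (g x), ← sq_abs (deriv g x)]
        field_simp
        ring
      have hsq : 0 ≤ c / 2 * (|g x| - 2 / c * |deriv g x|) ^ 2 := by positivity
      rw [Nat.cast_ofNat, Nat.add_one_sub_one, pow_one]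
      linarith
  rw [integral_const_mul, integral_const_mul] at hle
  refine ⟨(integrable_const_mul_iff (by simp [hc.ne']) _).1 hint, ?_⟩
  calc ∫ x in {x | R < |x - x₀|}, g x ^ 2 ∂gibbs V
      = 2 / c * (c / 2 * ∫ x in {x | R < |x - x₀|}, g x ^ 2 ∂gibbs V) := by field_simp
    _ ≤ _ := by
      gcongr
      refine hle.trans ?_
      gcongr
      · exact ae_of_all _ fun x => sq_nonneg _
      · exact Measure.restrict_le_self

lemma exists_sq_sub_le_of_abs_sub_le (h : HasPowerGrowth V x₀ R c M p) :
    ∃ B, 0 ≤ B ∧ ∀ f : ℝ → ℝ, ContDiff ℝ 1 f → Integrable (fun x => deriv f x ^ 2) (gibbs V) →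
      ∀ x, |x - x₀| ≤ R → (f x - f x₀) ^ 2 ≤ B * ∫ y, deriv f y ^ 2 ∂gibbs V := by
  obtain ⟨A, hA, hgrowth⟩ := h.exists_sq_sub_le
  have hp := h.one_le_p
  refine ⟨Real.exp (A * (1 + R ^ p)), by positivity, fun f hf hD x hx => ?_⟩
  exact (hgrowth f hf hD x).trans <| mul_le_mul_of_nonneg_right
    (Real.exp_le_exp.2 (by gcongr)) (integral_nonneg fun y => sq_nonneg _)

theorem poincare (h : HasPowerGrowth V x₀ R c M p) :
    ∃ C, 0 ≤ C ∧ ∀ f : ℝ → ℝ, ContDiff ℝ 1 f → Integrable (fun x => deriv f x ^ 2) (gibbs V) →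
      Integrable (fun x => (f x - f x₀) ^ 2) (gibbs V) ∧
        ∫ x, (f x - f x₀) ^ 2 ∂gibbs V ≤ C * ∫ x, deriv f x ^ 2 ∂gibbs V := by
  obtain ⟨B, hB, hball⟩ := h.exists_sq_sub_le_of_abs_sub_le
  have := isProbabilityMeasure_gibbs h.integrable_exp_neg
  have hc := h.c_pos
  set ρ := gibbsDensity V
  have hρ0 : ∀ x, 0 ≤ ρ x := fun x => (gibbsDensity_pos h.integrable_exp_neg x).le
  refine ⟨2 / c * (B * (ρ (x₀ - R) + ρ (x₀ + R)) + 2 / c) + B, by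
    have := hρ0 (x₀ - R); have := hρ0 (x₀ + R); positivity, fun f hf hD => ?_⟩
  have hcore := hball f hf hD
  have hR : |R| = R := abs_of_pos h.R_pos
  have hbdry_left := mul_le_mul_of_nonneg_right (hcore (x₀ - R) (by simp [hR])) (hρ0 (x₀ - R))
  have hbdry_right := mul_le_mul_of_nonneg_right (hcore (x₀ + R) (by simp [hR])) (hρ0 (x₀ + R))
  obtain ⟨hint, htail⟩ := h.poincare_tail (g := fun x => f x - f x₀)
    ((hf.differentiable one_ne_zero).sub_const _) (by simpa using hD)
  simp only [deriv_sub_const] at htail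
  set D := ∫ x, deriv f x ^ 2 ∂gibbs V
  obtain ⟨hint', hle⟩ := integrable_and_integral_le_of_integrableOn (G := fun _ => B * D)
    (measurableSet_lt (by fun_prop) (by fun_prop))
    ((hf.continuous.sub continuous_const).pow 2).aestronglyMeasurable (fun x => sq_nonneg _) hint
    (integrable_const _) (fun x => (sq_nonneg _).trans (hcore x₀ (by simp [h.R_pos.le])))
    fun x hx => hcore x (not_lt.1 hx)
  refine ⟨hint', hle.trans ?_⟩
  rw [integral_const, probReal_univ, one_smul, add_mul, mul_assoc (2 / c)]
  gcongr
  refine htail.trans ?_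
  gcongr
  linarith

variable {u P : ℝ → ℝ}

lemma rpow_moment_tail (h : HasPowerGrowth V x₀ R c M p) (hu : Differentiable ℝ u)
    (hu0 : ∀ x, 0 ≤ u x) (hu_int : Integrable u (gibbs V)) (hP_int : Integrable P (gibbs V))
    (hle : ∀ x, R ≤ |x - x₀| → |deriv u x| * |x - x₀| ≤ P x + c / 4 * (u x * |x - x₀| ^ p)) :
    IntegrableOn (fun x => u x * |x - x₀| ^ p) {x | R < |x - x₀|} (gibbs V) ∧
      c / 4 * ∫ x in {x | R < |x - x₀|}, u x * |x - x₀| ^ p ∂gibbs V ≤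
        ∫ x in {x | R < |x - x₀|}, P x + (1 + c * (2 * R) ^ p) * u x ∂gibbs V := by
  have hc := h.c_pos
  have hR := h.R_pos
  have hp := h.one_le_p
  have hH : ∀ x, R ≤ |x - x₀| → HasDerivAt (fun x => u x * (|x - x₀| - R))
      (deriv u x * (|x - x₀| - R) + u x * SignType.sign (x - x₀)) x := fun x hx =>
    (hu x).hasDerivAt.fun_mul ((by simpa using
      (hasDerivAt_abs (abs_pos.1 (hR.trans_le hx))).comp_sub_const x x₀ :
      HasDerivAt (fun x => |x - x₀|) _ x).sub_const R)
  obtain ⟨hint, htail⟩ := h.setIntegral_tail_le (W := fun x => c / 4 * (u x * |x - x₀| ^ p)) hH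
    (fun x hx => mul_nonneg (hu0 x) (sub_nonneg.2 hx))
    (hP_int.add (hu_int.const_mul (1 + c * (2 * R) ^ p)))
    (continuous_const.mul (hu.continuous.mul
      ((continuous_id.sub continuous_const).abs.rpow_const fun x => Or.inr (by linarith))))
    (fun x => by have := hu0 x; positivity) fun x hx => by
      have hsign : SignType.sign (x - x₀) * (deriv u x * (|x - x₀| - R) +
          u x * SignType.sign (x - x₀)) ≤ |deriv u x| * |x - x₀| + u x := by
        rw [mul_add]
        refine add_le_add ((sign_mul_le_abs _ _).trans ?_) ((sign_mul_le_abs _ _).trans ?_)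
        · rw [abs_mul, abs_of_nonneg (sub_nonneg.2 hx)]
          gcongr
          linarith
        · rw [abs_mul, abs_of_nonneg (hu0 x)]
          exact mul_le_of_le_one_right (hu0 x) (by
            rcases (SignType.sign (x - x₀)).trichotomy with h | h | h <;> simp [h])
      have hpow := mul_rpow_sub_one_self (abs_nonneg (x - x₀)) (by linarith : p ≠ 0)
      have hdrift := mul_le_mul_of_nonneg_left (mul_rpow_sub_one_le hR.le (abs_nonneg (x - x₀)) hp)
        (mul_nonneg hc.le (hu0 x))
      rw [Pi.add_apply]
      linear_combination hsign + hle x hx + hdrift - c * u x * hpow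
  rw [integral_const_mul] at htail
  refine ⟨(integrable_const_mul_iff (by simp [hc.ne']) _).1 hint, htail.trans_eq ?_⟩
  simp [abs_of_pos hR]

/-- `P` is the part of `|u'|` that the drift does not absorb. -/
theorem integrable_mul_rpow_and_integral_le (h : HasPowerGrowth V x₀ R c M p) :
    ∃ C, 0 ≤ C ∧ ∀ u P : ℝ → ℝ, Differentiable ℝ u → (∀ x, 0 ≤ u x) → (∀ x, 0 ≤ P x) →
      Integrable u (gibbs V) → Integrable P (gibbs V) →
      (∀ x, R ≤ |x - x₀| → |deriv u x| * |x - x₀| ≤ P x + c / 4 * (u x * |x - x₀| ^ p)) →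
      Integrable (fun x => u x * |x - x₀| ^ p) (gibbs V) ∧
        ∫ x, u x * |x - x₀| ^ p ∂gibbs V ≤ C * (∫ x, P x ∂gibbs V + ∫ x, u x ∂gibbs V) := by
  have hc := h.c_pos
  have hR := h.R_pos
  have hp : 0 ≤ p := by linarith [h.one_le_p]
  refine ⟨4 / c * (1 + c * (2 * R) ^ p) + R ^ p, by positivity,
    fun u P hu hu0 hP0 hu_int hP_int hle => ?_⟩
  obtain ⟨hint, htail⟩ := h.rpow_moment_tail hu hu0 hu_int hP_int hle
  obtain ⟨hint', hsum⟩ := integrable_and_integral_le_of_integrableOn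
    (F := fun x => u x * |x - x₀| ^ p) (G := fun x => R ^ p * u x)
    (measurableSet_lt measurable_const (by fun_prop))
    (hu.continuous.mul ((continuous_id.sub continuous_const).abs.rpow_const
      fun x => Or.inr hp)).aestronglyMeasurable
    (fun x => mul_nonneg (hu0 x) (by positivity)) hint (hu_int.const_mul _)
    (fun x => mul_nonneg (by positivity) (hu0 x)) fun x hx => by
      have hx' : |x - x₀| ≤ R := not_lt.1 hx
      have := hu0 x
      rw [mul_comm]
      gcongr
  refine ⟨hint', hsum.trans ?_⟩
  set k := c * (2 * R) ^ p
  have hk : 0 ≤ k := by positivity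
  have hIP : 0 ≤ ∫ x, P x ∂gibbs V := integral_nonneg hP0
  rw [integral_const_mul]
  calc ∫ x in {x | R < |x - x₀|}, u x * |x - x₀| ^ p ∂gibbs V + R ^ p * ∫ x, u x ∂gibbs V
      = 4 / c * (c / 4 * ∫ x in {x | R < |x - x₀|}, u x * |x - x₀| ^ p ∂gibbs V) +
          R ^ p * ∫ x, u x ∂gibbs V := by field_simp
    _ ≤ 4 / c * (∫ x, P x ∂gibbs V + (1 + k) * ∫ x, u x ∂gibbs V) +
          R ^ p * ∫ x, u x ∂gibbs V := by
        gcongr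
        exact htail.trans
          (setIntegral_add_const_mul_le hP_int hP0 hu_int hu0 (by linarith) _)
    _ ≤ (4 / c * (1 + k) + R ^ p) * (∫ x, P x ∂gibbs V + ∫ x, u x ∂gibbs V) := by
        have : 0 ≤ (4 / c * k + R ^ p) * ∫ x, P x ∂gibbs V := by positivity
        linarith

end HasPowerGrowth

section Energy

variable {q : ℝ}

lemma modH_nonneg (q y : ℝ) : 0 ≤ modH q y := by
  unfold modH
  split_ifs <;> positivity

lemma rpow_le_modH (hq : 2 ≤ q) (y : ℝ) : |y| ^ q ≤ modH q y := by
  unfold modH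
  split_ifs with h
  · rw [← sq_abs, ← Real.rpow_two]
    exact Real.rpow_le_rpow_of_exponent_ge' (abs_nonneg y) h zero_le_two hq
  · exact le_rfl

lemma sq_le_modH (hq : 2 ≤ q) (y : ℝ) : y ^ 2 ≤ modH q y := by
  unfold modH
  split_ifs with h
  · exact le_rfl
  · rw [← sq_abs, ← Real.rpow_two]
    exact Real.rpow_le_rpow_of_exponent_le (not_le.1 h).le hq

lemma energyDensity_nonneg (q : ℝ) (f : ℝ → ℝ) (x : ℝ) : 0 ≤ energyDensity q f x :=
  mul_nonneg (modH_nonneg _ _) (sq_nonneg _)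

lemma countable_setOf_eq_zero_and_deriv_ne_zero (f : ℝ → ℝ) :
    {x | f x = 0 ∧ deriv f x ≠ 0}.Countable := by
  refine (countable_setOfPred_isolated_right_within (s := {x | f x = 0})).mono fun x hx => ?_
  refine ⟨hx.1, ?_⟩
  have hne : ∀ᶠ z in 𝓝[≠] x, f z ≠ 0 :=
    (differentiableAt_of_deriv_ne_zero hx.2).hasDerivAt.eventually_ne hx.2
  rw [← empty_mem_iff_bot]
  filter_upwards [nhdsWithin_mono x (fun z hz => (ne_of_gt hz.2 : z ≠ x)) hne,
    self_mem_nhdsWithin] with z hz hz'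
  exact hz hz'.1

lemma sq_deriv_le_energyDensity_ae (hq : 2 ≤ q) (f : ℝ → ℝ) :
    ∀ᵐ x ∂(volume : Measure ℝ), deriv f x ^ 2 ≤ energyDensity q f x := by
  filter_upwards [(countable_setOf_eq_zero_and_deriv_ne_zero f).ae_notMem volume] with x hx
  rcases eq_or_ne (f x) 0 with h0 | h0
  · have hderiv : deriv f x = 0 := by simpa [h0] using hx
    simpa [hderiv] using energyDensity_nonneg q f x
  · have := mul_le_mul_of_nonneg_right (sq_le_modH hq (|deriv f x| / f x)) (sq_nonneg (f x))
    rwa [div_pow, sq_abs, div_mul_cancel₀ _ (pow_ne_zero 2 h0)] at this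

lemma energyDensity_div_const (q : ℝ) (f : ℝ → ℝ) {m : ℝ} (hm : 0 < m) (x : ℝ) :
    energyDensity q (fun y => f y / m) x = energyDensity q f x / m ^ 2 := by
  rw [energyDensity, energyDensity, deriv_div_const, abs_div, abs_of_pos hm,
    div_div_div_cancel_right₀ hm.ne', div_pow, mul_div_assoc]

end Energy

section Cutoff

lemma hasDerivAt_max_zero_rpow {q : ℝ} (hq : 1 < q) (y : ℝ) :
    HasDerivAt (fun y => max y 0 ^ q) (q * max y 0 ^ (q - 1)) y := by
  refine hasDerivAt_of_hasDerivAt_of_ne' (f := fun y : ℝ => max y 0 ^ q)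
    (g := fun y => q * max y 0 ^ (q - 1)) (x := 0) (fun y hy => ?_) ?_ ?_ y
  · rcases hy.lt_or_gt with h | h
    · rw [max_eq_right h.le, Real.zero_rpow (by linarith), mul_zero]
      refine (hasDerivAt_const y (0 : ℝ)).congr_of_eventuallyEq ?_
      filter_upwards [Iio_mem_nhds h] with z hz
      rw [max_eq_right (le_of_lt hz), Real.zero_rpow (by linarith)]
    · rw [max_eq_left h.le]
      refine (Real.hasDerivAt_rpow_const (Or.inl h.ne')).congr_of_eventuallyEq ?_
      filter_upwards [Ioi_mem_nhds h] with z hz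
      rw [max_eq_left (le_of_lt hz)]
  · exact ((continuous_id.max continuous_const).rpow_const
      fun _ => Or.inr (by linarith)).continuousAt
  · exact (continuous_const.mul ((continuous_id.max continuous_const).rpow_const
      fun _ => Or.inr (by linarith))).continuousAt

/-- The weight in `cutoff`: it vanishes for `|t| ≤ 2` and tends to `1` as `|t| → ∞`. -/
noncomputable def cutoffWeight (t : ℝ) : ℝ := max ((t ^ 2 - 4) / (t ^ 2 + 1)) 0

/-- A `C¹` truncation of `t ^ 2`, vanishing for `|t| ≤ 2`. It replaces `t ^ 2` in the entropy; the
exponent `q` of the weight makes Young's inequality applicable to its derivative. -/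
noncomputable def cutoff (q t : ℝ) : ℝ := t ^ 2 * cutoffWeight t ^ q

variable {q : ℝ}

lemma cutoffWeight_nonneg (t : ℝ) : 0 ≤ cutoffWeight t := le_max_right _ _

lemma cutoffWeight_le_one (t : ℝ) : cutoffWeight t ≤ 1 :=
  max_le ((div_le_one (by positivity)).2 (by linarith)) zero_le_one

lemma cutoffWeight_eq_zero {t : ℝ} (ht : |t| ≤ 2) : cutoffWeight t = 0 :=
  max_eq_right (div_nonpos_of_nonpos_of_nonneg
    (by nlinarith [sq_abs t, abs_nonneg t]) (by positivity))

lemma half_le_cutoffWeight {t : ℝ} (ht : 4 ≤ |t|) : 1 / 2 ≤ cutoffWeight t :=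
  le_max_of_le_left ((le_div_iff₀ (by positivity)).2 (by nlinarith [sq_abs t]))

lemma cutoff_nonneg (q t : ℝ) : 0 ≤ cutoff q t :=
  mul_nonneg (sq_nonneg t) (Real.rpow_nonneg (cutoffWeight_nonneg t) q)

lemma cutoff_le_sq (hq : 0 ≤ q) (t : ℝ) : cutoff q t ≤ t ^ 2 :=
  mul_le_of_le_one_right (sq_nonneg t)
    (Real.rpow_le_one (cutoffWeight_nonneg t) (cutoffWeight_le_one t) hq)

lemma cutoff_le_sq_sub (hq : 0 < q) (t : ℝ) : cutoff q t ≤ 4 * (|t| - 1) ^ 2 := by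
  rcases le_total |t| 2 with h | h
  · rw [cutoff, cutoffWeight_eq_zero h, Real.zero_rpow hq.ne', mul_zero]
    positivity
  · refine (cutoff_le_sq hq.le t).trans ?_
    nlinarith [sq_abs t]

lemma sq_le_cutoff (hq : 0 ≤ q) {t : ℝ} (ht : 4 ≤ |t|) : t ^ 2 ≤ 2 ^ q * cutoff q t := by
  have hweight : 1 ≤ 2 ^ q * cutoffWeight t ^ q := by
    rw [← Real.mul_rpow zero_le_two (cutoffWeight_nonneg t)]
    exact Real.one_le_rpow (by linarith [half_le_cutoffWeight ht]) hq
  rw [cutoff, mul_left_comm]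
  exact le_mul_of_one_le_right (sq_nonneg t) hweight

lemma hasDerivAt_cutoff (hq : 1 < q) (t : ℝ) :
    HasDerivAt (cutoff q) (t * cutoffWeight t ^ (q - 1) *
      (2 * cutoffWeight t + 10 * q * (t ^ 2 / (t ^ 2 + 1) ^ 2))) t := by
  have hden : t ^ 2 + 1 ≠ 0 := by positivity
  have hsq : HasDerivAt (fun t : ℝ => t ^ 2) (2 * t) t := by simpa using hasDerivAt_pow 2 t
  refine (hsq.fun_mul ((hasDerivAt_max_zero_rpow hq _).comp t
    ((hsq.sub_const 4).fun_div (hsq.add_const 1) hden))).congr_deriv ?_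
  change 2 * t * cutoffWeight t ^ q + t ^ 2 * (q * cutoffWeight t ^ (q - 1) * _) = _
  rw [← mul_rpow_sub_one_self (cutoffWeight_nonneg t) (by linarith : q ≠ 0)]
  field_simp
  ring

lemma abs_deriv_cutoff_le (hq : 1 < q) (t : ℝ) :
    |deriv (cutoff q) t| ≤ (2 + 10 * q) * (|t| * cutoffWeight t ^ (q - 1)) := by
  have hw := cutoffWeight_nonneg t
  have hfrac : t ^ 2 / (t ^ 2 + 1) ^ 2 ≤ 1 :=
    (div_le_one (by positivity)).2 (by nlinarith [sq_nonneg t, sq_nonneg (t ^ 2)])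
  have hfactor : 0 ≤ 2 * cutoffWeight t + 10 * q * (t ^ 2 / (t ^ 2 + 1) ^ 2) := by positivity
  rw [(hasDerivAt_cutoff hq t).deriv, abs_mul, abs_mul, abs_of_nonneg hfactor,
    abs_of_nonneg (Real.rpow_nonneg hw (q - 1)), mul_comm]
  gcongr ?_ * _
  nlinarith [cutoffWeight_le_one t]

lemma exists_young_inequality {ε : ℝ} (hq : 1 < q) (hε : 0 < ε) :
    ∃ K : ℝ, 0 ≤ K ∧ ∀ a b : ℝ, 0 ≤ a → 0 ≤ b → a * b ≤ K * a ^ q + ε * b ^ (q / (q - 1)) := by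
  have hconj : q.HolderConjugate (q / (q - 1)) := Real.HolderConjugate.conjExponent hq
  set r := q / (q - 1)
  have hr : 0 < r := hconj.symm.pos
  set δ := ε ^ r⁻¹
  have hδr : δ ^ r = ε := Real.rpow_inv_rpow hε.le hr.ne'
  have hδ₀ : 0 < δ := by positivity
  refine ⟨δ⁻¹ ^ q, by positivity, fun a b ha hb => ?_⟩
  calc a * b = δ⁻¹ * a * (δ * b) := by field_simp
    _ ≤ (δ⁻¹ * a) ^ q / q + (δ * b) ^ r / r :=
      Real.young_inequality_of_nonneg (by positivity) (by positivity) hconj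
    _ ≤ (δ⁻¹ * a) ^ q + (δ * b) ^ r := by
      gcongr
      · exact div_le_self (by positivity) hq.le
      · exact div_le_self (by positivity) hconj.symm.lt.le
    _ = δ⁻¹ ^ q * a ^ q + ε * b ^ r := by
      rw [Real.mul_rpow (by positivity) ha, Real.mul_rpow hδ₀.le hb, hδr]

lemma exists_abs_deriv_cutoff_mul_le {p ε : ℝ} (hq : 2 ≤ q) (hp : q / (q - 1) ≤ p) (hε : 0 < ε) :
    ∃ K : ℝ, 0 ≤ K ∧ ∀ (f : ℝ → ℝ) (x d : ℝ), 1 ≤ d →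
      |deriv (cutoff q) (f x) * deriv f x| * d ≤
        K * energyDensity q f x + ε * (cutoff q (f x) * d ^ p) := by
  have hq₁ : 1 < q := by linarith
  set L := 2 + 10 * q
  have hL : 0 < L := by positivity
  obtain ⟨K, hK, hyoung⟩ := exists_young_inequality hq₁ (div_pos hε hL)
  refine ⟨L * K, by positivity, fun f x d hd => ?_⟩
  set t := f x with ht
  set w := cutoffWeight t
  have hw : 0 ≤ w := cutoffWeight_nonneg t
  have hcutoff := abs_deriv_cutoff_le hq₁ t
  rcases le_or_gt |t| 2 with hsmall | hlarge
  · rw [cutoffWeight_eq_zero hsmall, Real.zero_rpow (by linarith), mul_zero, mul_zero] at hcutoff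
    rw [abs_mul, le_antisymm hcutoff (abs_nonneg _), zero_mul, zero_mul]
    have := energyDensity_nonneg q f x
    have := cutoff_nonneg q t
    positivity
  set y := |deriv f x| / |t| with hy
  have ht₀ : 0 < |t| := by linarith
  have hpow : (w ^ (q - 1) * d) ^ (q / (q - 1)) ≤ w ^ q * d ^ p := by
    rw [Real.mul_rpow (by positivity) (by positivity), ← Real.rpow_mul hw,
      mul_div_cancel₀ q (by linarith : q - 1 ≠ 0)]
    gcongr
  have hmodH : y ^ q ≤ modH q (|deriv f x| / t) := by
    simpa only [abs_div, abs_abs] using rpow_le_modH hq (|deriv f x| / t)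
  calc |deriv (cutoff q) t * deriv f x| * d
      = |deriv (cutoff q) t| * (y * |t|) * d := by rw [abs_mul, hy, div_mul_cancel₀ _ ht₀.ne']
    _ ≤ L * (|t| * w ^ (q - 1)) * (y * |t|) * d := by gcongr
    _ = L * |t| ^ 2 * (y * (w ^ (q - 1) * d)) := by ring
    _ ≤ L * |t| ^ 2 * (K * y ^ q + ε / L * (w ^ (q - 1) * d) ^ (q / (q - 1))) := by
      gcongr
      exact hyoung _ _ (by positivity) (by positivity)
    _ ≤ L * |t| ^ 2 * (K * modH q (|deriv f x| / t) + ε / L * (w ^ q * d ^ p)) := by gcongr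
    _ = L * K * energyDensity q f x + ε * (cutoff q t * d ^ p) := by
      rw [energyDensity, ← ht, sq_abs, show cutoff q t = t ^ 2 * w ^ q from rfl]
      field_simp

end Cutoff

section Entropy

lemma sq_mul_log_sq_sub_nonneg (t : ℝ) : 0 ≤ t ^ 2 * Real.log (t ^ 2) - t ^ 2 + 1 := by
  linarith [Real.self_sub_one_le_mul_log (sq_nonneg t)]

lemma sq_mul_log_sq_sub_le (t : ℝ) :
    t ^ 2 * Real.log (t ^ 2) - t ^ 2 + 1 ≤ (2 * |t| + 1) * (|t| - 1) ^ 2 := by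
  rcases eq_or_ne t 0 with rfl | ht
  · simp
  have hlog := mul_le_mul_of_nonneg_left (Real.log_le_sub_one_of_pos (abs_pos.2 ht)) (sq_nonneg |t|)
  rw [← sq_abs t, Real.log_pow, Nat.cast_two]
  linarith

lemma sq_mul_log_sq_sub_le_cutoff {q t L : ℝ} (hq : 0 ≤ q) (hL : 0 ≤ L)
    (hlog : Real.log (t ^ 2) ≤ L) :
    t ^ 2 * Real.log (t ^ 2) - t ^ 2 + 1 ≤ 9 * (|t| - 1) ^ 2 + 2 ^ q * (cutoff q t * L) := by
  have hcutoff := cutoff_nonneg q t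
  rcases le_total |t| 4 with h | h
  · refine (sq_mul_log_sq_sub_le t).trans (le_add_of_le_of_nonneg ?_ (by positivity))
    gcongr
    linarith
  · have hlog' := mul_le_mul_of_nonneg_left hlog (sq_nonneg t)
    have hcutoff' := mul_le_mul_of_nonneg_right (sq_le_cutoff hq h) hL
    nlinarith [sq_abs t, sq_nonneg (|t| - 1)]

variable {Ω : Type*} [MeasurableSpace Ω] {μ : Measure Ω} {f : Ω → ℝ}

lemma integrable_cutoff_comp {q : ℝ} (hq : 1 < q) (hf : MemLp f 2 μ) :
    Integrable (fun x => cutoff q (f x)) μ := by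
  have hcont : Continuous (cutoff q) :=
    continuous_iff_continuousAt.2 fun t => (hasDerivAt_cutoff hq t).continuousAt
  refine hf.integrable_sq.mono' (hcont.comp_aestronglyMeasurable hf.aestronglyMeasurable)
    (ae_of_all _ fun x => ?_)
  rw [Real.norm_of_nonneg (cutoff_nonneg q _)]
  exact cutoff_le_sq (by linarith) (f x)

variable [IsProbabilityMeasure μ]

lemma integral_cutoff_le {q : ℝ} (hq : 1 < q) (hf : MemLp f 2 μ) :
    ∫ x, cutoff q (f x) ∂μ ≤ 4 * ∫ x, (|f x| - 1) ^ 2 ∂μ := by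
  rw [← integral_const_mul]
  exact integral_mono (integrable_cutoff_comp hq hf)
    ((hf.abs.sub (memLp_const 1)).integrable_sq.const_mul 4)
    fun x => cutoff_le_sq_sub (by linarith) (f x)

lemma integral_sq_abs_sub_one_le (hf : MemLp f 2 μ) (hf₁ : ∫ x, f x ^ 2 ∂μ = 1) (a : ℝ) :
    ∫ x, (|f x| - 1) ^ 2 ∂μ ≤ 2 * ∫ x, (f x - a) ^ 2 ∂μ := by
  have hexpand : ∀ b, ∫ x, (|f x| - b) ^ 2 ∂μ = 1 - 2 * b * ∫ x, |f x| ∂μ + b ^ 2 := fun b => by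
    have hcross : Integrable (fun x => 2 * b * |f x|) μ :=
      (hf.integrable one_le_two).abs.const_mul _
    have hlin : Integrable (fun x => f x ^ 2 - 2 * b * |f x|) μ := hf.integrable_sq.sub hcross
    have hdec : ∀ x, (|f x| - b) ^ 2 = f x ^ 2 - 2 * b * |f x| + b ^ 2 := fun x => by
      rw [sub_sq, sq_abs]
      ring
    simp_rw [hdec]
    rw [integral_add hlin (integrable_const _),
      integral_sub hf.integrable_sq hcross, integral_const_mul, hf₁]
    simp
  have hshift : ∫ x, (|f x| - |a|) ^ 2 ∂μ ≤ ∫ x, (f x - a) ^ 2 ∂μ :=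
    integral_mono (hf.abs.sub (memLp_const _)).integrable_sq (hf.sub (memLp_const a)).integrable_sq
      fun x => sq_le_sq.2 (abs_abs_sub_abs_le (f x) a)
  have hmean : 0 ≤ ∫ x, |f x| ∂μ := integral_nonneg fun x => abs_nonneg _
  have hvar : 0 ≤ ∫ x, (|f x| - ∫ y, |f y| ∂μ) ^ 2 ∂μ := integral_nonneg fun x => sq_nonneg _
  rw [hexpand] at hvar hshift ⊢
  set A := ∫ x, |f x| ∂μ
  nlinarith [sq_nonneg (A - |a|)]

lemma integral_sq_mul_log_sq_le (hf : MemLp f 2 μ) (hf₁ : ∫ x, f x ^ 2 ∂μ = 1) {B : Ω → ℝ}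
    (hB : Integrable B μ) (hle : ∀ x, f x ^ 2 * Real.log (f x ^ 2) - f x ^ 2 + 1 ≤ B x) :
    Integrable (fun x => f x ^ 2 * Real.log (f x ^ 2)) μ ∧
      ∫ x, f x ^ 2 * Real.log (f x ^ 2) ∂μ ≤ ∫ x, B x ∂μ := by
  have hmeas : AEMeasurable f μ := hf.aestronglyMeasurable.aemeasurable
  have hint : Integrable (fun x => f x ^ 2 * Real.log (f x ^ 2) - f x ^ 2 + 1) μ :=
    hB.mono' (by fun_prop) <| ae_of_all _ fun x => by
      rw [Real.norm_of_nonneg (sq_mul_log_sq_sub_nonneg _)]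
      exact hle x
  have hcorr : Integrable (fun x => f x ^ 2 - 1) μ := hf.integrable_sq.sub (integrable_const _)
  have hcorr₀ : ∫ x, (f x ^ 2 - 1) ∂μ = 0 := by
    rw [integral_sub hf.integrable_sq (integrable_const _), hf₁]
    simp
  have hsplit : ∀ x, f x ^ 2 * Real.log (f x ^ 2) =
      f x ^ 2 * Real.log (f x ^ 2) - f x ^ 2 + 1 + (f x ^ 2 - 1) := fun x => by ring
  refine ⟨(hint.add hcorr).congr (ae_of_all _ fun x => (hsplit x).symm), ?_⟩
  rw [integral_congr_ae (ae_of_all _ hsplit), integral_add hint hcorr, hcorr₀, add_zero]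
  exact integral_mono hint hB hle

lemma integral_sq_mul_log_sq_le_cutoff {q K D : ℝ} {w : Ω → ℝ} (hq : 1 < q) (hK : 0 ≤ K)
    (hD : 0 ≤ D) (hw : ∀ x, 0 ≤ w x) (hf : MemLp f 2 μ) (hf₁ : ∫ x, f x ^ 2 ∂μ = 1)
    (hlog : ∀ x, Real.log (f x ^ 2) ≤ K * (1 + w x) + D)
    (hint : Integrable (fun x => cutoff q (f x) * w x) μ) :
    Integrable (fun x => f x ^ 2 * Real.log (f x ^ 2)) μ ∧
      ∫ x, f x ^ 2 * Real.log (f x ^ 2) ∂μ ≤ 9 * ∫ x, (|f x| - 1) ^ 2 ∂μ +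
        2 ^ q * ((K + D) * ∫ x, cutoff q (f x) ∂μ + K * ∫ x, cutoff q (f x) * w x ∂μ) := by
  have hdist : Integrable (fun x => 9 * (|f x| - 1) ^ 2) μ :=
    (hf.abs.sub (memLp_const 1)).integrable_sq.const_mul 9
  have hcutoff : Integrable (fun x => (K + D) * cutoff q (f x)) μ :=
    (integrable_cutoff_comp hq hf).const_mul _
  have hsum : Integrable
      (fun x => 2 ^ q * ((K + D) * cutoff q (f x) + K * (cutoff q (f x) * w x))) μ :=
    (hcutoff.add (hint.const_mul K)).const_mul _
  have hpointwise : ∀ x, f x ^ 2 * Real.log (f x ^ 2) - f x ^ 2 + 1 ≤ 9 * (|f x| - 1) ^ 2 +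
      2 ^ q * ((K + D) * cutoff q (f x) + K * (cutoff q (f x) * w x)) := fun x => by
    have hL : 0 ≤ K * (1 + w x) + D := by
      have := hw x
      positivity
    refine (sq_mul_log_sq_sub_le_cutoff (by linarith : 0 ≤ q) hL (hlog x)).trans_eq ?_
    ring
  obtain ⟨hint', hle⟩ := integral_sq_mul_log_sq_le hf hf₁ (hdist.add hsum) hpointwise
  refine ⟨hint', hle.trans_eq ?_⟩
  simp only [Pi.add_apply]
  rw [integral_add hdist hsum, integral_const_mul, integral_const_mul,
    integral_add hcutoff (hint.const_mul K), integral_const_mul, integral_const_mul]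

lemma log_sq_le {A C D a s t : ℝ} (hA : 0 ≤ A) (hC : 0 ≤ C) (hD : 0 ≤ D) (hs : 1 ≤ s)
    (ha : a ^ 2 ≤ 2 + 2 * (C * D)) (hta : (t - a) ^ 2 ≤ Real.exp (A * s) * D) :
    Real.log (t ^ 2) ≤ (Real.log (6 + 4 * C) + A) * s + D := by
  have hlog : 0 ≤ Real.log (6 + 4 * C) := Real.log_nonneg (by linarith)
  rcases eq_or_ne t 0 with rfl | ht
  · rw [zero_pow two_ne_zero, Real.log_zero]
    positivity
  have hexp : 1 ≤ Real.exp (A * s) := Real.one_le_exp (by positivity)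
  have hsq : t ^ 2 ≤ (6 + 4 * C) * Real.exp (A * s) * (1 + D) := by
    have hCD : C * D ≤ Real.exp (A * s) * (C * D) := le_mul_of_one_le_left (by positivity) hexp
    have hCexp : 0 ≤ C * Real.exp (A * s) := by positivity
    have : 0 ≤ D * Real.exp (A * s) := by positivity
    nlinarith [sq_nonneg (t - a - a)]
  calc Real.log (t ^ 2) ≤ Real.log ((6 + 4 * C) * Real.exp (A * s) * (1 + D)) :=
        Real.log_le_log (by positivity) hsq
    _ = Real.log (6 + 4 * C) + A * s + Real.log (1 + D) := by
        rw [Real.log_mul (by positivity) (by positivity), Real.log_mul (by positivity)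
          (by positivity), Real.log_exp]
    _ ≤ (Real.log (6 + 4 * C) + A) * s + D := by
        have := Real.log_le_sub_one_of_pos (by positivity : 0 < 1 + D)
        nlinarith

end Entropy

lemma satisfiesMLS_of_normalized {q C : ℝ} {μ : Measure ℝ} (hC : 0 ≤ C)
    (hsq : ∀ f : ℝ → ℝ, ContDiff ℝ ∞ f → Integrable (energyDensity q f) μ →
      Integrable (fun x => f x ^ 2) μ)
    (h : ∀ f : ℝ → ℝ, ContDiff ℝ ∞ f → Integrable (energyDensity q f) μ → ∫ x, f x ^ 2 ∂μ = 1 →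
      Integrable (fun x => f x ^ 2 * Real.log (f x ^ 2)) μ ∧
        ∫ x, f x ^ 2 * Real.log (f x ^ 2) ∂μ ≤ C * ∫ x, energyDensity q f x ∂μ) :
    SatisfiesMLS q μ := by
  refine ⟨C + 1, by positivity, fun f hf he => ⟨hsq f hf he, ?_⟩⟩
  have hE : 0 ≤ ∫ x, energyDensity q f x ∂μ := integral_nonneg (energyDensity_nonneg q f)
  rcases (integral_nonneg fun x => sq_nonneg (f x) : 0 ≤ ∫ x, f x ^ 2 ∂μ).eq_or_lt with h₀ | h₀
  · have hzero : entropyDensity μ f = fun _ => 0 := funext fun x => by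
      rw [entropyDensity, ← h₀, div_zero, Real.log_zero, mul_zero]
    rw [hzero, integral_zero]
    exact ⟨integrable_zero _ _ _, by positivity⟩
  obtain ⟨m, hm, hm₂⟩ : ∃ m : ℝ, 0 < m ∧ ∫ x, f x ^ 2 ∂μ = m ^ 2 :=
    ⟨√(∫ x, f x ^ 2 ∂μ), Real.sqrt_pos.2 h₀, (Real.sq_sqrt h₀.le).symm⟩
  have henergy : energyDensity q (fun x => f x / m) = fun x => energyDensity q f x / m ^ 2 :=
    funext (energyDensity_div_const q f hm)
  have hentropy : entropyDensity μ f =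
      fun x => m ^ 2 * ((f x / m) ^ 2 * Real.log ((f x / m) ^ 2)) := funext fun x => by
    rw [entropyDensity, hm₂, div_pow]
    field_simp
  obtain ⟨hint, hle⟩ := h (fun x => f x / m) (hf.div_const m)
    (by rw [henergy]; exact he.div_const _)
    (by simp_rw [div_pow]; rw [integral_div, hm₂, div_self (by positivity)])
  rw [henergy, integral_div] at hle
  rw [hentropy, integral_const_mul]
  refine ⟨hint.const_mul _, ?_⟩
  calc m ^ 2 * ∫ x, (f x / m) ^ 2 * Real.log ((f x / m) ^ 2) ∂μ
      ≤ m ^ 2 * (C * ((∫ x, energyDensity q f x ∂μ) / m ^ 2)) := by gcongr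
    _ = C * ∫ x, energyDensity q f x ∂μ := by field_simp
    _ ≤ (C + 1) * ∫ x, energyDensity q f x ∂μ := by gcongr; linarith

lemma integrable_sq_deriv_and_integral_le {q : ℝ} {μ : Measure ℝ} {f : ℝ → ℝ} (hq : 2 ≤ q)
    (hμ : μ ≪ volume) (he : Integrable (energyDensity q f) μ) :
    Integrable (fun x => deriv f x ^ 2) μ ∧
      ∫ x, deriv f x ^ 2 ∂μ ≤ ∫ x, energyDensity q f x ∂μ := by
  have hae : ∀ᵐ x ∂μ, deriv f x ^ 2 ≤ energyDensity q f x :=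
    hμ.ae_le (sq_deriv_le_energyDensity_ae hq f)
  have hint : Integrable (fun x => deriv f x ^ 2) μ :=
    he.mono' ((measurable_deriv f).pow_const 2).aestronglyMeasurable <| hae.mono fun x hx => by
      rwa [Real.norm_of_nonneg (sq_nonneg _)]
  exact ⟨hint, integral_mono_ae hint he hae⟩

namespace HasPowerGrowth

variable {V : ℝ → ℝ} {x₀ R c M p q : ℝ}

lemma memLp_two (h : HasPowerGrowth V x₀ R c M p) {f : ℝ → ℝ} (hf : ContDiff ℝ 1 f)
    (hD : Integrable (fun x => deriv f x ^ 2) (gibbs V)) : MemLp f 2 (gibbs V) := by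
  have := isProbabilityMeasure_gibbs h.integrable_exp_neg
  obtain ⟨_, _, hpoincare⟩ := h.poincare
  have hcont := hf.continuous
  have hsub : MemLp (fun x => f x - f x₀) 2 (gibbs V) :=
    (memLp_two_iff_integrable_sq (by fun_prop)).2 (hpoincare f hf hD).1
  simpa only [Pi.add_def, sub_add_cancel] using hsub.add (memLp_const (f x₀))

lemma exists_log_sq_le (h : HasPowerGrowth V x₀ R c M p) :
    ∃ K, 0 ≤ K ∧ ∀ f : ℝ → ℝ, ContDiff ℝ 1 f → Integrable (fun x => deriv f x ^ 2) (gibbs V) →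
      ∫ x, f x ^ 2 ∂gibbs V = 1 →
      ∀ x, Real.log (f x ^ 2) ≤ K * (1 + |x - x₀| ^ p) + ∫ y, deriv f y ^ 2 ∂gibbs V := by
  have := isProbabilityMeasure_gibbs h.integrable_exp_neg
  obtain ⟨A, hA, hgrowth⟩ := h.exists_sq_sub_le
  obtain ⟨C, hC, hpoincare⟩ := h.poincare
  have hlog : 0 ≤ Real.log (6 + 4 * C) := Real.log_nonneg (by linarith)
  refine ⟨Real.log (6 + 4 * C) + A, by positivity, fun f hf hD hf₁ x => ?_⟩
  have hf₂ : Integrable (fun x => f x ^ 2) (gibbs V) := (h.memLp_two hf hD).integrable_sq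
  obtain ⟨hint, hle⟩ := hpoincare f hf hD
  have hcenter : f x₀ ^ 2 ≤ 2 + 2 * (C * ∫ y, deriv f y ^ 2 ∂gibbs V) := by
    have hmono : ∫ _, f x₀ ^ 2 ∂gibbs V ≤ ∫ y, (2 * f y ^ 2 + 2 * (f y - f x₀) ^ 2) ∂gibbs V :=
      integral_mono (integrable_const _) ((hf₂.const_mul 2).add (hint.const_mul 2)) fun y => by
        beta_reduce
        nlinarith [sq_nonneg (f y + (f y - f x₀))]
    rw [integral_add (hf₂.const_mul 2) (hint.const_mul 2), integral_const_mul,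
      integral_const_mul, hf₁, integral_const, probReal_univ, one_smul] at hmono
    linarith
  exact log_sq_le hA hC (integral_nonneg fun y => sq_nonneg _)
    (le_add_of_nonneg_right (by positivity)) hcenter (hgrowth f hf hD x)

lemma exists_integral_cutoff_mul_rpow_le (h : HasPowerGrowth V x₀ R c M p) (hq : 2 ≤ q)
    (hp : q / (q - 1) ≤ p) :
    ∃ C, 0 ≤ C ∧ ∀ f : ℝ → ℝ, Differentiable ℝ f →
      Integrable (fun x => cutoff q (f x)) (gibbs V) → Integrable (energyDensity q f) (gibbs V) →
      Integrable (fun x => cutoff q (f x) * |x - x₀| ^ p) (gibbs V) ∧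
        ∫ x, cutoff q (f x) * |x - x₀| ^ p ∂gibbs V ≤
          C * (∫ x, energyDensity q f x ∂gibbs V + ∫ x, cutoff q (f x) ∂gibbs V) := by
  obtain ⟨K, hK, hyoung⟩ :=
    exists_abs_deriv_cutoff_mul_le hq hp (div_pos h.c_pos (by norm_num : (0 : ℝ) < 4))
  obtain ⟨C, hC, hmoment⟩ := h.integrable_mul_rpow_and_integral_le
  refine ⟨C * (K + 1), by positivity, fun f hf hcutoff he => ?_⟩
  have hcutoff₀ := fun x => cutoff_nonneg q (f x)
  have hderiv : ∀ x, HasDerivAt (fun x => cutoff q (f x))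
      (deriv (cutoff q) (f x) * deriv f x) x := fun x =>
    (hasDerivAt_cutoff (by linarith) (f x)).differentiableAt.hasDerivAt.comp x (hf x).hasDerivAt
  obtain ⟨hint, hle⟩ := hmoment (fun x => cutoff q (f x)) (fun x => K * energyDensity q f x)
    (fun x => (hderiv x).differentiableAt) hcutoff₀
    (fun x => mul_nonneg hK (energyDensity_nonneg q f x)) hcutoff (he.const_mul K) fun x hx => by
      rw [(hderiv x).deriv]
      exact hyoung f x _ (h.one_le_R.trans hx)
  refine ⟨hint, hle.trans ?_⟩
  have hE : 0 ≤ ∫ x, energyDensity q f x ∂gibbs V := integral_nonneg (energyDensity_nonneg q f)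
  have hI : 0 ≤ ∫ x, cutoff q (f x) ∂gibbs V := integral_nonneg hcutoff₀
  rw [integral_const_mul, mul_assoc]
  gcongr
  nlinarith

lemma exists_integral_sq_abs_sub_one_le (h : HasPowerGrowth V x₀ R c M p) (hq : 2 ≤ q) :
    ∃ C, 0 ≤ C ∧ ∀ f : ℝ → ℝ, ContDiff ℝ 1 f → Integrable (energyDensity q f) (gibbs V) →
      ∫ x, f x ^ 2 ∂gibbs V = 1 →
      ∫ x, (|f x| - 1) ^ 2 ∂gibbs V ≤ C * ∫ x, energyDensity q f x ∂gibbs V := by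
  have := isProbabilityMeasure_gibbs h.integrable_exp_neg
  obtain ⟨C, hC, hpoincare⟩ := h.poincare
  refine ⟨2 * C, by positivity, fun f hf he hf₁ => ?_⟩
  obtain ⟨hD, hDE⟩ := integrable_sq_deriv_and_integral_le hq (gibbs_absolutelyContinuous V) he
  calc ∫ x, (|f x| - 1) ^ 2 ∂gibbs V ≤ 2 * ∫ x, (f x - f x₀) ^ 2 ∂gibbs V :=
        integral_sq_abs_sub_one_le (h.memLp_two hf hD) hf₁ (f x₀)
    _ ≤ 2 * (C * ∫ x, deriv f x ^ 2 ∂gibbs V) := by gcongr; exact (hpoincare f hf hD).2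
    _ ≤ 2 * C * ∫ x, energyDensity q f x ∂gibbs V := by rw [mul_assoc]; gcongr

lemma exists_integral_sq_mul_log_sq_le (h : HasPowerGrowth V x₀ R c M p) (hq : 2 ≤ q)
    (hp : q / (q - 1) ≤ p) :
    ∃ C, 0 ≤ C ∧ ∀ f : ℝ → ℝ, ContDiff ℝ 1 f → Integrable (energyDensity q f) (gibbs V) →
      ∫ x, f x ^ 2 ∂gibbs V = 1 →
      Integrable (fun x => f x ^ 2 * Real.log (f x ^ 2)) (gibbs V) ∧
        ∫ x, f x ^ 2 * Real.log (f x ^ 2) ∂gibbs V ≤ C * ∫ x, energyDensity q f x ∂gibbs V := by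
  have := isProbabilityMeasure_gibbs h.integrable_exp_neg
  have hq₁ : 1 < q := by linarith
  obtain ⟨C₁, hC₁, hquadratic⟩ := h.exists_integral_sq_abs_sub_one_le hq
  obtain ⟨C₂, hC₂, hmoment⟩ := h.exists_integral_cutoff_mul_rpow_le hq hp
  obtain ⟨K, hK, hlog⟩ := h.exists_log_sq_le
  refine ⟨9 * C₁ + 2 ^ q * (K * (4 * C₁ + C₂ * (1 + 4 * C₁)) + 1), by positivity,
    fun f hf he hf₁ => ?_⟩
  obtain ⟨hD, hDE⟩ := integrable_sq_deriv_and_integral_le hq (gibbs_absolutelyContinuous V) he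
  have hf₂ : MemLp f 2 (gibbs V) := h.memLp_two hf hD
  have hcutoff := integrable_cutoff_comp hq₁ hf₂
  obtain ⟨hJ, hJE⟩ := hmoment f (hf.differentiable one_ne_zero) hcutoff he
  have hdist := hquadratic f hf he hf₁
  have hI := integral_cutoff_le hq₁ hf₂
  have hI₁ : ∫ x, cutoff q (f x) ∂gibbs V ≤ 1 :=
    hf₁ ▸ integral_mono hcutoff hf₂.integrable_sq fun x => cutoff_le_sq (by linarith) (f x)
  have hD₀ : 0 ≤ ∫ x, deriv f x ^ 2 ∂gibbs V := integral_nonneg fun x => sq_nonneg _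
  obtain ⟨hint, hle⟩ := integral_sq_mul_log_sq_le_cutoff hq₁ hK hD₀
    (fun x => by positivity) hf₂ hf₁ (hlog f hf hD hf₁) hJ
  refine ⟨hint, hle.trans ?_⟩
  set E := ∫ x, energyDensity q f x ∂gibbs V
  set D := ∫ x, deriv f x ^ 2 ∂gibbs V
  set I := ∫ x, cutoff q (f x) ∂gibbs V
  set J := ∫ x, cutoff q (f x) * |x - x₀| ^ p ∂gibbs V
  have hIE : I ≤ 4 * C₁ * E := by linarith
  have hJE' : J ≤ C₂ * (1 + 4 * C₁) * E := hJE.trans (by rw [mul_assoc]; gcongr; linarith)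
  have hDI : D * I ≤ E := (mul_le_of_le_one_right hD₀ hI₁).trans hDE
  calc 9 * ∫ x, (|f x| - 1) ^ 2 ∂gibbs V + 2 ^ q * ((K + D) * I + K * J)
      ≤ 9 * (C₁ * E) + 2 ^ q * (K * (4 * C₁ * E) + E + K * (C₂ * (1 + 4 * C₁) * E)) := by
        rw [add_mul K D]
        gcongr
    _ = (9 * C₁ + 2 ^ q * (K * (4 * C₁ + C₂ * (1 + 4 * C₁)) + 1)) * E := by ring

theorem satisfiesMLS (h : HasPowerGrowth V x₀ R c M p) (hq : 2 ≤ q) (hp : q / (q - 1) ≤ p) :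
    SatisfiesMLS q (gibbs V) := by
  obtain ⟨C, hC, hle⟩ := h.exists_integral_sq_mul_log_sq_le hq hp
  refine satisfiesMLS_of_normalized hC (fun f hf he => ?_) fun f hf => hle f (hf.of_le (by simp))
  obtain ⟨hD, _⟩ := integrable_sq_deriv_and_integral_le hq (gibbs_absolutelyContinuous V) he
  exact (h.memLp_two (hf.of_le (by simp)) hD).integrable_sq

end HasPowerGrowth

lemma aemeasurable_of_ae_continuousAt {α β : Type*} [TopologicalSpace α] [MeasurableSpace α]
    [OpensMeasurableSpace α] [TopologicalSpace β] [MeasurableSpace β] [BorelSpace β]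
    {μ : Measure α} {f : α → β} (h : ∀ᵐ x ∂μ, ContinuousAt f x) : AEMeasurable f μ := by
  have hcont : ContinuousOn f {x | ContinuousAt f x} := fun x hx =>
    ContinuousAt.continuousWithinAt hx
  have hmeas : NullMeasurableSet {x | ContinuousAt f x} μ :=
    NullMeasurableSet.of_compl (NullMeasurableSet.of_null h)
  rw [← Measure.restrict_eq_self_of_ae_mem (s := {x | ContinuousAt f x}) h]
  exact hcont.aemeasurable₀ hmeas

lemma integrable_exp_neg_mul_abs_sub {c : ℝ} (hc : 0 < c) (x₀ : ℝ) :
    Integrable fun x : ℝ => Real.exp (-c * |x - x₀|) := by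
  have hpos : IntegrableOn (fun x : ℝ => Real.exp (-c * |x|)) (Ioi 0) :=
    (exp_neg_integrableOn_Ioi 0 hc).congr_fun
      (fun x hx => by rw [abs_of_pos (mem_Ioi.1 hx)]) measurableSet_Ioi
  have hneg : IntegrableOn (fun x : ℝ => Real.exp (-c * |x|)) (Iic 0) :=
    (integrableOn_exp_mul_Iic hc 0).congr_fun
      (fun x hx => by rw [abs_of_nonpos (mem_Iic.1 hx), neg_mul_neg]) measurableSet_Iic
  have habs : Integrable fun x : ℝ => Real.exp (-c * |x|) := by
    rw [← integrableOn_univ, ← Iic_union_Ioi (a := (0 : ℝ))]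
    exact hneg.union hpos
  exact habs.comp_sub_right x₀

/-- Outside `[-r, r]`, `V` is the potential `|x - x₀| ^ p` with an oscillating perturbation whose
derivative is comparable to that of `|x - x₀| ^ p`. -/
def IsCosPerturbation (p k x₀ r : ℝ) (V : ℝ → ℝ) : Prop :=
  ∀ x, r < |x| → V x = |x - x₀| ^ p + k * |x - x₀| ^ (p - 1) * Real.cos x

namespace IsCosPerturbation

variable {p k x₀ r : ℝ} {V : ℝ → ℝ}

lemma hasDerivAt (h : IsCosPerturbation p k x₀ r V) {x : ℝ} (hx : r < |x|) (hne : x ≠ x₀) :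
    HasDerivAt V (SignType.sign (x - x₀) *
      (p * |x - x₀| ^ (p - 1) + k * (p - 1) * |x - x₀| ^ (p - 1 - 1) * Real.cos x) -
        k * |x - x₀| ^ (p - 1) * Real.sin x) x := by
  have hdist : |x - x₀| ≠ 0 := abs_ne_zero.2 (sub_ne_zero.2 hne)
  have hpow : ∀ s, HasDerivAt (fun y => |y - x₀| ^ s)
      (SignType.sign (x - x₀) * s * |x - x₀| ^ (s - 1)) x := fun s =>
    ((hasDerivAt_abs (sub_ne_zero.2 hne)).comp_sub_const x x₀).rpow_const (Or.inl hdist)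
  have hV : V =ᶠ[𝓝 x] fun y => |y - x₀| ^ p + k * |y - x₀| ^ (p - 1) * Real.cos y :=
    (continuousAt_const.eventually_lt continuous_abs.continuousAt hx).mono h
  exact (((hpow p).fun_add (((hpow (p - 1)).const_mul k).fun_mul
    (Real.hasDerivAt_cos x))).congr_deriv (by ring)).congr_of_eventuallyEq hV

lemma le_sign_mul_deriv (h : IsCosPerturbation p k x₀ r V) (hp : 1 ≤ p) (hk : |k| < p) {x : ℝ}
    (hx : r < |x|) (hd : 1 ≤ |x - x₀|) (hfar : 2 * |k| * (p - 1) / (p - |k|) ≤ |x - x₀|) :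
    (p - |k|) / 2 * |x - x₀| ^ (p - 1) ≤ SignType.sign (x - x₀) * deriv V x := by
  have hne : x - x₀ ≠ 0 := abs_pos.1 (by linarith)
  have hsign : (SignType.sign (x - x₀) : ℝ) * SignType.sign (x - x₀) = 1 := by
    rcases hne.lt_or_gt with hlt | hlt <;> simp [hlt]
  rw [(h.hasDerivAt hx (sub_ne_zero.1 hne)).deriv]
  set s := (SignType.sign (x - x₀) : ℝ)
  set d := |x - x₀|
  have hp₁ : 0 ≤ p - 1 := by linarith
  have hcos : -(|k| * (p - 1) * d ^ (p - 1 - 1)) ≤ k * (p - 1) * d ^ (p - 1 - 1) * Real.cos x := by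
    refine neg_le_of_abs_le ?_
    rw [abs_mul, abs_mul, abs_mul, abs_of_nonneg hp₁,
      abs_of_nonneg (by positivity : 0 ≤ d ^ (p - 1 - 1))]
    exact mul_le_of_le_one_right (by positivity) (Real.abs_cos_le_one x)
  have hsin : s * (k * d ^ (p - 1) * Real.sin x) ≤ |k| * d ^ (p - 1) := by
    refine (sign_mul_le_abs _ _).trans ?_
    rw [abs_mul, abs_mul, abs_of_nonneg (by positivity : 0 ≤ d ^ (p - 1))]
    exact mul_le_of_le_one_right (by positivity) (Real.abs_sin_le_one x)
  have hlower : |k| * (p - 1) * d ^ (p - 1 - 1) ≤ (p - |k|) / 2 * d ^ (p - 1) := by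
    rw [div_le_iff₀ (by linarith)] at hfar
    rw [Real.rpow_sub_one (by linarith : d ≠ 0) (p - 1), ← mul_div_assoc,
      div_le_iff₀ (by linarith : 0 < d)]
    nlinarith [Real.rpow_nonneg (abs_nonneg (x - x₀)) (p - 1)]
  calc (p - |k|) / 2 * d ^ (p - 1)
      ≤ p * d ^ (p - 1) + k * (p - 1) * d ^ (p - 1 - 1) * Real.cos x -
          s * (k * d ^ (p - 1) * Real.sin x) := by linarith
    _ = _ := by linear_combination -(p * d ^ (p - 1) +
        k * (p - 1) * d ^ (p - 1 - 1) * Real.cos x) * hsign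

lemma exists_abs_sub_rpow_le (h : IsCosPerturbation p k x₀ r V) (hp : 1 ≤ p)
    (hb : ∃ M, ∀ x, |x| ≤ r → |V x - |x - x₀| ^ p| ≤ M) :
    ∃ B, 0 ≤ B ∧ ∀ x, |V x - |x - x₀| ^ p| ≤ |x - x₀| ^ p / 2 + B := by
  obtain ⟨M, hM⟩ := hb
  refine ⟨(2 * |k|) ^ p + |M|, by positivity, fun x => ?_⟩
  rcases le_or_gt |x| r with hx | hx
  · have := (hM x hx).trans (le_abs_self M)
    have : 0 ≤ |x - x₀| ^ p / 2 + (2 * |k|) ^ p := by positivity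
    linarith
  · rw [h x hx, add_sub_cancel_left, abs_mul, abs_mul,
      abs_of_nonneg (by positivity : 0 ≤ |x - x₀| ^ (p - 1))]
    refine (mul_le_of_le_one_right (by positivity) (Real.abs_cos_le_one x)).trans ?_
    linarith [mul_rpow_sub_one_le (abs_nonneg k) (abs_nonneg (x - x₀)) hp, abs_nonneg M]

lemma integrable_exp_neg (h : IsCosPerturbation p k x₀ r V) (hp : 1 ≤ p)
    (hb : ∃ M, ∀ x, |x| ≤ r → |V x - |x - x₀| ^ p| ≤ M) (hV : AEMeasurable V) :
    Integrable fun x => Real.exp (-V x) := by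
  obtain ⟨B, _, hB⟩ := h.exists_abs_sub_rpow_le hp hb
  refine ((integrable_exp_neg_mul_abs_sub one_half_pos x₀).const_mul
    (Real.exp (1 / 2 + B))).mono' (by fun_prop) (ae_of_all _ fun x => ?_)
  rw [Real.norm_of_nonneg (Real.exp_pos _).le, ← Real.exp_add]
  have := self_le_one_add_rpow (abs_nonneg (x - x₀)) hp
  exact Real.exp_le_exp.2 (by linarith [neg_le_of_abs_le (hB x)])

lemma exists_hasPowerGrowth (h : IsCosPerturbation p k x₀ r V) (hp : 1 ≤ p) (hk : |k| < p)
    (hb : ∃ M, ∀ x, |x| ≤ r → |V x - |x - x₀| ^ p| ≤ M) (hV : AEMeasurable V) :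
    ∃ R c M, HasPowerGrowth V x₀ R c M p := by
  obtain ⟨B, hB₀, hB⟩ := h.exists_abs_sub_rpow_le hp hb
  have hfar : 0 ≤ 2 * |k| * (p - 1) / (p - |k|) :=
    div_nonneg (mul_nonneg (by positivity) (by linarith)) (by linarith)
  set R := 1 + |x₀| + |r| + 2 * |k| * (p - 1) / (p - |k|)
  have hR : ∀ x, R ≤ |x - x₀| → r < |x| ∧ 1 ≤ |x - x₀| := fun x hx => by
    have := abs_sub x x₀
    have := le_abs_self r
    have := abs_nonneg x₀
    have := abs_nonneg r
    constructor <;> linarith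
  refine ⟨R, (p - |k|) / 2, 3 / 2 + B, ?_⟩
  exact
    { one_le_p := hp
      one_le_R := by linarith [abs_nonneg x₀, abs_nonneg r]
      c_pos := by linarith
      M_nonneg := by positivity
      integrable_exp_neg := h.integrable_exp_neg hp hb hV
      le_rpow := fun x => by
        have : 0 ≤ B * |x - x₀| ^ p := by positivity
        linarith [le_of_abs_le (hB x)]
      differentiableAt := fun x hx => (h.hasDerivAt (hR x hx).1
        (sub_ne_zero.1 (abs_pos.1 (by linarith [(hR x hx).2])))).differentiableAt
      le_sign_mul_deriv := fun x hx => h.le_sign_mul_deriv hp hk (hR x hx).1 (hR x hx).2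
        (by linarith [abs_nonneg x₀, abs_nonneg r]) }

/-- Convexity forces `V' a ≤ V' (a + π)`, while the sine terms push the derivative up at `a` and
down at `a + π`. -/
lemma le_of_convexOn (h : IsCosPerturbation p k x₀ r V) (hV : ConvexOn ℝ univ V) {a : ℝ}
    (hr : r < a) (hx₀ : x₀ < a) (hcos : Real.cos a = 0) (hsin : k * Real.sin a = -|k|) :
    p + |k| ≤ (p - |k|) * (1 + Real.pi / (a - x₀)) ^ (p - 1) := by
  have hpos : 0 < a - x₀ := sub_pos.2 hx₀
  have hpos' : 0 < a + Real.pi - x₀ := by linarith [Real.pi_pos]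
  have hda := h.hasDerivAt (hr.trans_le (le_abs_self a)) hx₀.ne'
  have hdb := h.hasDerivAt (x := a + Real.pi)
    (by linarith [le_abs_self (a + Real.pi), Real.pi_pos]) (sub_pos.1 hpos').ne'
  rw [sign_pos hpos, abs_of_pos hpos, hcos] at hda
  rw [sign_pos hpos', abs_of_pos hpos', Real.cos_add_pi, Real.sin_add_pi, hcos] at hdb
  have hslope := (hV.le_slope_of_hasDerivAt (mem_univ _) (mem_univ _)
    (lt_add_of_pos_right a Real.pi_pos) hda).trans
    (hV.slope_le_of_hasDerivAt (mem_univ _) (mem_univ _) (lt_add_of_pos_right a Real.pi_pos) hdb)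
  have hshift : (a + Real.pi - x₀) ^ (p - 1) =
      (a - x₀) ^ (p - 1) * (1 + Real.pi / (a - x₀)) ^ (p - 1) := by
    have := Real.pi_pos
    rw [← Real.mul_rpow hpos.le (by positivity)]
    congr 1
    field_simp
    ring
  rw [hshift] at hslope
  refine le_of_mul_le_mul_left ?_ (Real.rpow_pos_of_pos hpos (p - 1))
  simp only [SignType.coe_one] at hslope
  linear_combination hslope +
    ((a - x₀) ^ (p - 1) + (a - x₀) ^ (p - 1) * (1 + Real.pi / (a - x₀)) ^ (p - 1)) * hsin

lemma not_convexOn (h : IsCosPerturbation p k x₀ r V) (hk : k ≠ 0) : ¬ ConvexOn ℝ univ V := by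
  intro hV
  obtain ⟨θ, hcos, hsin⟩ : ∃ θ, Real.cos θ = 0 ∧ k * Real.sin θ = -|k| := by
    rcases hk.lt_or_gt with hk | hk
    · exact ⟨Real.pi / 2, Real.cos_pi_div_two, by simp [abs_of_neg hk]⟩
    · exact ⟨-(Real.pi / 2), by simp, by simp [abs_of_pos hk]⟩
  have ha : Tendsto (fun n : ℕ => θ + n * (2 * Real.pi)) atTop atTop :=
    tendsto_atTop_add_const_left _ _
      (tendsto_natCast_atTop_atTop.atTop_mul_const Real.two_pi_pos)
  have hlim : Tendsto (fun n : ℕ =>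
      (p - |k|) * (1 + Real.pi / (θ + n * (2 * Real.pi) - x₀)) ^ (p - 1)) atTop
      (𝓝 ((p - |k|) * (1 + 0) ^ (p - 1))) :=
    (((tendsto_const_nhds.div_atTop (tendsto_atTop_add_const_right _ (-x₀) ha)).const_add
      1).rpow_const (Or.inl (by norm_num))).const_mul _
  have hle : p + |k| ≤ (p - |k|) * (1 + 0) ^ (p - 1) := by
    refine ge_of_tendsto hlim ?_
    filter_upwards [ha.eventually_gt_atTop r, ha.eventually_gt_atTop x₀] with n hr hx₀
    exact h.le_of_convexOn hV hr hx₀ (by rwa [Real.cos_add_nat_mul_two_pi])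
      (by rwa [Real.sin_add_nat_mul_two_pi])
  rw [add_zero, Real.one_rpow] at hle
  linarith [abs_pos.2 hk]

end IsCosPerturbation

end ModifiedLogSobolev

open ModifiedLogSobolev

theorem corollary1_general (p q k x₀ r : ℝ) (hq : 2 ≤ q) (hp : q / (q - 1) ≤ p)
    (hk₀ : k ≠ 0) (hk : |k| < p)
    (α V : ℝ → ℝ)
    (hα : ∀ x : ℝ, r < |x| → α x = k * dist x₀ x ^ (p - 1))
    (hα_bdd : ∃ M : ℝ, ∀ x : ℝ, |x| ≤ r → |α x| ≤ M)
    (hV : ∀ x : ℝ, V x = dist x₀ x ^ p + α x * Real.cos x)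
    (hV_meas : AEMeasurable V) :
    IsProbabilityMeasure (gibbs V) ∧ ¬ ConvexOn ℝ Set.univ V ∧ SatisfiesMLS q (gibbs V) := by
  have hp₁ : 1 ≤ p := ((one_le_div (by linarith)).2 (by linarith)).trans hp
  simp only [dist_comm x₀, Real.dist_eq] at hα hV
  have hcos : IsCosPerturbation p k x₀ r V := fun x hx => by rw [hV, hα x hx]
  have hbdd : ∃ M, ∀ x, |x| ≤ r → |V x - |x - x₀| ^ p| ≤ M := by
    refine hα_bdd.imp fun M hM x hx => ?_
    rw [hV, add_sub_cancel_left, abs_mul]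
    exact (mul_le_of_le_one_right (abs_nonneg _) (Real.abs_cos_le_one x)).trans (hM x hx)
  obtain ⟨R, c, M, hgrowth⟩ := hcos.exists_hasPowerGrowth hp₁ hk hbdd hV_meas
  exact ⟨isProbabilityMeasure_gibbs hgrowth.integrable_exp_neg, hcos.not_convexOn hk₀,
    hgrowth.satisfiesMLS hq hp⟩

theorem corollary1 (p q k x₀ : ℝ) (hq : 2 < q) (hp : q / (q - 1) ≤ p)
    (hk₀ : 0 < k) (hk₁ : k < 1)
    (α V : ℝ → ℝ)
    (hα : ∀ x : ℝ, 1 < |x| → α x = k * dist x₀ x ^ (p - 1))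
    (hα_bdd : ∃ M : ℝ, ∀ x : ℝ, |x| ≤ 1 → |α x| ≤ M)
    (hV : ∀ x : ℝ, V x = dist x₀ x ^ p + α x * Real.cos x)
    (hV_diff : ∀ᵐ x ∂(volume : Measure ℝ), DifferentiableAt ℝ V x) :
    IsProbabilityMeasure (ModifiedLogSobolev.gibbs V) ∧
      ¬ ConvexOn ℝ Set.univ V ∧
      ModifiedLogSobolev.SatisfiesMLS q (ModifiedLogSobolev.gibbs V) := by
  have hkp : |k| < p := (abs_of_pos hk₀).trans_lt <| hk₁.trans_le <|
    ((one_le_div (by linarith)).2 (by linarith)).trans hp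
  exact corollary1_general p q k x₀ 1 hq.le hp hk₀.ne' hkp α V hα hα_bdd hV
    (aemeasurable_of_ae_continuousAt (hV_diff.mono fun _ h => h.continuousAt))
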